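/- \textbf{Setting (linear Computational Ludics).} Fix a countably infinite set of variables with a distinguished variable $x_0$ and a signature: a set $A$ of names, each $a\in A$ with an arity $\mathsf{ar}(a)\in\mathbb N$. \emph{Positive} c-designs $P$ and \emph{negative} c-designs $N$ are the possibly infinite trees generated coinductively by $$P ::= \maltese \mid \Omega \mid N_0|\overline a\langle N_1,\dots,N_k\rangle\ \ (k=\mathsf{ar}(a)),\qquad N ::= x \mid \textstyle\sum_{a\in A} a(\vec x_a).P_a ,$$ where the $\mathsf{ar}(a)$ distinct variables $\vec x_a$ are bound in $P_a$; c-designs are taken up to renaming of bound variables, which are chosen distinct from the free ones. Cut reduction is $(\sum a(\vec x_a).P_a)|\overline a\langle\vec N\rangle\longrightarrow P_a[\vec N/\vec x_a]$, and $P$ \emph{converges to} $\maltese$ if $P\longrightarrow^*\maltese$. A c-design $T$ is \emph{standard} if it contains no cut, is not a variable and contains no subdesign $N_0|\overline a\langle N_1,\dots,N_k\rangle$ in which some $N_l$ ($l\ge1$) is a variable, is not $\Omega$, is linear (in each subdesign $N_0|\overline a\langle N_1,\dots,N_k\rangle$ the sets of free variables of $N_0,\dots,N_k$ are pairwise disjoint),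 and has finitely many free variables. A positive c-design is \emph{atomic} if its free variables are among $\{x_0\}$, a negative one if it is closed. For atomic $P,N$ put $P\perp N$ iff $P[N/x_0]$ is closed and converges to $\maltese$. For a set $\mathbf T$ of atomic c-designs of one polarity, $\mathbf T^\perp$ is the set of standard atomic c-designs of the other polarity orthogonal to all elements of $\mathbf T$. An \emph{a-behaviour} is a set $\mathbf T$ of standard atomic c-designs of one polarity with $\mathbf T=\mathbf T^{\perp\perp}$. For negative a-behaviours $\mathbf N_1,\dots,\mathbf N_k$ and distinct variables $x_1,\dots,x_k$, $[\mathbf N_1/x_1,\dots,\mathbf N_k/x_k]^\perp$ denotes the set of standard positive $P$ such that $P[N_1/x_1,\dots,N_k/x_k]$ is closed and converges to $\maltese$ for all $N_i\in\mathbf N_i$; and, if $k=\mathsf{ar}(a)$, $\overline a\langle\mathbf N_1,\dots,\mathbf N_k\rangle$ is the set of all $x_0|\overline a\langle N_1,\dots,N_k\rangle$ with $N_i\in\mathbf N_i$. An \emph{$n$-ary connective} is $\alpha=(\vec z,\alpha^I,\alpha^E)$, where $\vec z=z_1,\dots,z_n$ are distinct variables different from $x_0$, and $\alpha^I,\alpha^E$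 are finite sets of negative actions $a_i(\vec x_i)$, $\vec x_i=x_{(i,1)},\dots,x_{(i,k)}$ being $k=\mathsf{ar}(a_i)$ distinct variables from $\vec z$, such that distinct actions in $\alpha^I\cup\alpha^E$ have distinct names and every $z_j$ occurs in some action of $\alpha^I\cup\alpha^E$. Write $\mathbf N_{(i,l)}=\mathbf N_j$ and $\mathbf P_{(i,l)}=\mathbf P_j$ when $x_{(i,l)}=z_j$. For negative a-behaviours $\mathbf N_j$ and positive a-behaviours $\mathbf P_j$, put $$\alpha^E\langle\mathbf N_1,\dots,\mathbf N_n\rangle=\Big(\bigcup_{a_i(\vec x_i)\in\alpha^E}\overline{a_i}\langle\mathbf N_{(i,1)},\dots,\mathbf N_{(i,k)}\rangle\Big)^{\perp\perp},$$ $$\alpha^I(\mathbf P_1,\dots,\mathbf P_n)=\bigcap_{a_i(\vec x_i)\in\alpha^I}\overline{a_i}\langle\mathbf P_{(i,1)}^\perp,\dots,\mathbf P_{(i,k)}^\perp\rangle^\perp$$ (an intersection among the standard atomic negative c-designs), and $$\alpha^I(\mathbf P_1,\dots,\mathbf P_n)^{\mathsf C}=\bigcup_{a_i(\vec x_i)\in\alpha^I}\overline{a_i}\langle\mathbf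 P_{(i,1)}^\perp,\dots,\mathbf P_{(i,k)}^\perp\rangle .$$ The connective $\alpha$ satisfies the \emph{harmony condition} if $\alpha^E\subseteq\alpha^I$ (inversion) and $\alpha^I\subseteq\alpha^E$ (recovery). \textbf{Proposition.} If an $n$-ary connective $\alpha$ satisfies the harmony condition, then $\alpha$ is dually decomposable, that is: \begin{enumerate} \item for all negative a-behaviours $\mathbf N_1,\dots,\mathbf N_n$, $$\alpha^E\langle\mathbf N_1,\dots,\mathbf N_n\rangle=\alpha^I(\mathbf N_1^\perp,\dots,\mathbf N_n^\perp)^{\mathsf C}\cup\{\maltese\};$$ \item for all positive a-behaviours $\mathbf P_1,\dots,\mathbf P_n$ and every standard atomic negative c-design $\sum a(\vec x_a).P_a$, $$\textstyle\sum a(\vec x_a).P_a\in\alpha^I(\mathbf P_1,\dots,\mathbf P_n)$$ holds if and only if $$P_{a_i}\in[\mathbf P_{(i,1)}^\perp/x_{(i,1)},\dots,\mathbf P_{(i,k)}^\perp/x_{(i,k)}]^\perp$$ for every $a_i(x_{(i,1)},\dots,x_{(i,k)})\in\alpha^E$, where the bound variables $\vec x_{a_i}$ are taken to be $\vec x_i$.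 \end{enumerate} -/

import Mathlib

/-!
Linear computational ludics.

C-designs are taken up to renaming of bound variables, by means of de Bruijn indices.  Variables
are natural numbers.  In `∑ a(x₁,…,x_k).P_a` the branch `P_a` refers to the bound variables
`x₁, …, x_k` by the indices `0, …, k-1` and to a variable `m` that is not bound there by `k + m`.
The distinguished variable `x₀` is the variable `0`.
-/

universe u

namespace Ludics

/-- A signature: a set of names, each with an arity. -/
structure Signature where
  Name : Type u
  ar : Name → ℕ

/-- One layer of a negative c-design with positive subdesigns in `X`: a variable, or a family
`∑ a(x⃗_a).P_a` indexed by all names. -/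
inductive NegF (S : Signature.{u}) (X : Type u) : Type u where
  | var (x : ℕ) : NegF S X
  | sum (P : S.Name → X) : NegF S X

/-- One layer of a positive c-design with deeper positive subdesigns in `X`: daimon, divergence, or
`N₀ | ā⟨N₁,…,N_k⟩` with `k` the arity of `a`. -/
inductive PosF (S : Signature.{u}) (X : Type u) : Type u where
  | daimon : PosF S X
  | omega : PosF S X
  | act (a : S.Name) (N₀ : NegF S X) (N : Fin (S.ar a) → NegF S X) : PosF S X

namespace NegF

variable {S : Signature.{u}} {X Y : Type u}

def map (f : X → Y) : NegF S X → NegF S Y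
  | var x => var x
  | sum P => sum fun a => f (P a)

/-- The variable at the root, if the root is a variable. -/
def var? : NegF S X → Option ℕ
  | var x => some x
  | sum _ => none

/-- The branches at the root, if the root is not a variable. -/
def branch : (N : NegF S X) → N.var? = none → S.Name → X
  | var _, h => nomatch h
  | sum P, _ => P

def ofParts : (v : Option ℕ) → (v = none → S.Name → X) → NegF S X
  | some x, _ => var x
  | none, P => sum (P rfl)

theorem ofParts_branch (N : NegF S X) : ofParts N.var? N.branch = N := by
  cases N <;> rfl

theorem map_ofParts (f : X → Y) (v : Option ℕ) (P : v = none → S.Name → X) :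
    (ofParts v P).map f = ofParts v fun h a => f (P h a) := by
  cases v <;> rfl

end NegF

namespace PosF

variable {S : Signature.{u}} {X Y : Type u}

def map (f : X → Y) : PosF S X → PosF S Y
  | daimon => daimon
  | omega => omega
  | act a N₀ N => act a (N₀.map f) fun l => (N l).map f

instance : Functor (PosF S) where
  map := map

/-- The shapes of one layer of a positive c-design; `v none` and `v (some l)` tell whether `N₀` and
`N_l` are variables, and which. -/
inductive Shape (S : Signature.{u}) : Type u where
  | daimon : Shape S
  | omega : Shape S
  | act (a : S.Name) (v : Option (Fin (S.ar a)) → Option ℕ) : Shape S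

/-- The deeper positive subdesigns of a layer of the given shape. -/
def Slot : Shape S → Type u
  | Shape.daimon => PEmpty
  | Shape.omega => PEmpty
  | Shape.act _ v => {l // v l = none} × S.Name

def poly (S : Signature.{u}) : PFunctor.{u, u} := ⟨Shape S, Slot⟩

def ofPoly : poly S X → PosF S X
  | ⟨Shape.daimon, _⟩ => daimon
  | ⟨Shape.omega, _⟩ => omega
  | ⟨Shape.act a v, f⟩ =>
      act a (NegF.ofParts (v none) fun h b => f (⟨none, h⟩, b))
        fun l => NegF.ofParts (v (some l)) fun h b => f (⟨some l, h⟩, b)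

/-- The immediate negative subdesigns of `N₀ | ā⟨N₁,…,N_k⟩`. -/
def child {k : ℕ} (N₀ : NegF S X) (N : Fin k → NegF S X) : Option (Fin k) → NegF S X
  | none => N₀
  | some l => N l

def toPoly : PosF S X → poly S X
  | daimon => ⟨Shape.daimon, fun i => nomatch i⟩
  | omega => ⟨Shape.omega, fun i => nomatch i⟩
  | act a N₀ N => ⟨Shape.act a fun l => (child N₀ N l).var?,
      fun i => (child N₀ N i.1.1).branch i.1.2 i.2⟩

/-- One-layer positive c-designs form a polynomial functor, so that the largest set of labelled
trees with these layers is available as `QPF.Cofix`. -/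
instance : QPF (PosF S) where
  P := poly S
  abs := ofPoly
  repr := toPoly
  abs_repr := by
    rintro α (_ | _ | ⟨a, N₀, N⟩)
    · rfl
    · rfl
    · show act a _ _ = _
      congr 1
      · exact NegF.ofParts_branch N₀
      · funext l
        exact NegF.ofParts_branch (N l)
  abs_map := by
    rintro α β f ⟨_ | _ | ⟨a, v⟩, g⟩
    · rfl
    · rfl
    · show act a _ _ = act a _ _
      congr 1
      · exact (NegF.map_ofParts f _ _).symm
      · funext l
        exact (NegF.map_ofParts f _ _).symm

end PosF

/-- Positive c-designs: the possibly infinite trees whose layers are as in `PosF`. -/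
def Pos (S : Signature.{u}) : Type u := QPF.Cofix (PosF S)

/-- Negative c-designs. -/
abbrev Neg (S : Signature.{u}) : Type u := NegF S (Pos S)

/-- C-designs of either polarity. -/
inductive Design (S : Signature.{u}) : Type u where
  | pos (P : Pos S) : Design S
  | neg (N : Neg S) : Design S

variable {S : Signature.{u}}

namespace Pos

/-- The root layer of a positive c-design. -/
def dest (P : Pos S) : PosF S (Pos S) := QPF.Cofix.dest P

/-- Definition by corecursion. -/
def corec {X : Type u} (f : X → PosF S X) (x : X) : Pos S := QPF.Cofix.corec f x

theorem dest_corec {X : Type u} (f : X → PosF S X) (x : X) :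
    dest (corec f x) = (f x).map (corec f) := QPF.Cofix.dest_corec f x

/-- The positive c-design with a given root layer. -/
def mk : PosF S (Pos S) → Pos S := corec (PosF.map dest)

theorem mk_dest (P : Pos S) : mk P.dest = P := by
  refine QPF.Cofix.bisim_rel (fun x y => x = mk (dest y)) ?_ _ _ rfl
  rintro _ y rfl
  have h : QPF.Cofix.dest (mk (dest y)) = (fun z => mk (dest z)) <$> QPF.Cofix.dest y := by
    have h1 := dest_corec (PosF.map dest) (dest y)
    have h2 : PosF.map (mk (S := S)) (PosF.map dest (dest y))
        = mk <$> dest <$> QPF.Cofix.dest y := rfl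
    have h3 := QPF.comp_map (F := PosF S) dest mk (QPF.Cofix.dest y)
    exact h1.trans (h2.trans h3.symm)
  rw [h]
  refine (QPF.comp_map (F := PosF S) (fun z => mk (dest z)) (Quot.mk _) _).symm.trans ?_
  refine congrArg (fun g => g <$> QPF.Cofix.dest y) (funext fun z => ?_)
  exact Quot.sound rfl

theorem dest_mk (P : PosF S (Pos S)) : dest (mk P) = P := by
  have h1 : dest (mk P) = (P.map dest).map mk := dest_corec _ _
  have h2 : (P.map dest).map mk = (fun z => mk (dest z)) <$> P :=
    (QPF.comp_map (F := PosF S) dest mk P).symm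
  have h3 : (fun z : Pos S => mk (dest z)) = id := funext mk_dest
  rw [h1, h2, h3]
  exact QPF.id_map P

def daimon : Pos S := mk PosF.daimon

def omega : Pos S := mk PosF.omega

/-- `N₀ | ā⟨N₁,…,N_k⟩`. -/
def act (a : S.Name) (N₀ : Neg S) (N : Fin (S.ar a) → Neg S) : Pos S := mk (PosF.act a N₀ N)

end Pos

/-! ### Renaming and substitution -/

/-- A renaming carried under a binder of `k` variables. -/
def liftRen (k : ℕ) (ρ : ℕ → ℕ) (i : ℕ) : ℕ := if i < k then i else ρ (i - k) + k

/-- One layer of a renaming. -/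
def NegF.renameStep (ρ : ℕ → ℕ) : Neg S → NegF S ((ℕ → ℕ) × Pos S)
  | var x => var (ρ x)
  | sum P => sum fun a => (liftRen (S.ar a) ρ, P a)

def PosF.renameStep (ρ : ℕ → ℕ) : PosF S (Pos S) → PosF S ((ℕ → ℕ) × Pos S)
  | daimon => daimon
  | omega => omega
  | act a N₀ N => act a (N₀.renameStep ρ) fun l => (N l).renameStep ρ

/-- Renaming of the free variables of a positive c-design. -/
def Pos.rename (ρ : ℕ → ℕ) (P : Pos S) : Pos S :=
  Pos.corec (fun s : (ℕ → ℕ) × Pos S => s.2.dest.renameStep s.1) (ρ, P)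

/-- Renaming of the free variables of a negative c-design. -/
def NegF.rename (ρ : ℕ → ℕ) (N : Neg S) : Neg S :=
  (N.renameStep ρ).map fun s => s.2.rename s.1

/-- A simultaneous substitution carried under a binder of `k` variables. -/
def liftSubst (k : ℕ) (σ : ℕ → Neg S) (i : ℕ) : Neg S :=
  if i < k then NegF.var i else (σ (i - k)).rename (· + k)

/-- One layer of a substitution.  A substituted c-design is copied, that is, traversed with the
identical substitution. -/
def NegF.substStep (σ : ℕ → Neg S) : Neg S → NegF S ((ℕ → Neg S) × Pos S)
  | var x => (σ x).map fun P => (NegF.var, P)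
  | sum P => sum fun a => (liftSubst (S.ar a) σ, P a)

def PosF.substStep (σ : ℕ → Neg S) : PosF S (Pos S) → PosF S ((ℕ → Neg S) × Pos S)
  | daimon => daimon
  | omega => omega
  | act a N₀ N => act a (N₀.substStep σ) fun l => (N l).substStep σ

/-- Simultaneous capture-avoiding substitution `P[σ x / x]` for all variables `x`. -/
def Pos.subst (σ : ℕ → Neg S) (P : Pos S) : Pos S :=
  Pos.corec (fun s : (ℕ → Neg S) × Pos S => s.2.dest.substStep s.1) (σ, P)

/-- The substitution `[N / x₀]`. -/
def single (N : Neg S) (x : ℕ) : Neg S := if x = 0 then N else NegF.var x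

/-- The substitution `[N₁ / x₁, …, N_k / x_k]` that removes a binder of the variables
`x₁, …, x_k`. -/
def instantiate {k : ℕ} (N : Fin k → Neg S) (i : ℕ) : Neg S :=
  if h : i < k then N ⟨i, h⟩ else NegF.var (i - k)

/-! ### Subdesigns, free variables, standard c-designs -/

/-- `Subdesign U T`: `U` is a subtree of `T`. -/
inductive Subdesign (U : Design S) : Design S → Prop
  | refl : Subdesign U U
  | head {a : S.Name} {N₀ : Neg S} {N : Fin (S.ar a) → Neg S} :
      Subdesign U (Design.neg N₀) → Subdesign U (Design.pos (Pos.act a N₀ N))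
  | arg {a : S.Name} {N₀ : Neg S} {N : Fin (S.ar a) → Neg S} (l : Fin (S.ar a)) :
      Subdesign U (Design.neg (N l)) → Subdesign U (Design.pos (Pos.act a N₀ N))
  | branch {P : S.Name → Pos S} (a : S.Name) :
      Subdesign U (Design.pos (P a)) → Subdesign U (Design.neg (NegF.sum P))

/-- `FreeIn x T`: the variable `x` occurs free in `T`. -/
inductive FreeIn : ℕ → Design S → Prop
  | var (x : ℕ) : FreeIn x (Design.neg (NegF.var x))
  | head {x : ℕ} {a : S.Name} {N₀ : Neg S} {N : Fin (S.ar a) → Neg S} :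
      FreeIn x (Design.neg N₀) → FreeIn x (Design.pos (Pos.act a N₀ N))
  | arg {x : ℕ} {a : S.Name} {N₀ : Neg S} {N : Fin (S.ar a) → Neg S} (l : Fin (S.ar a)) :
      FreeIn x (Design.neg (N l)) → FreeIn x (Design.pos (Pos.act a N₀ N))
  | branch {x : ℕ} {P : S.Name → Pos S} (a : S.Name) :
      FreeIn (S.ar a + x) (Design.pos (P a)) → FreeIn x (Design.neg (NegF.sum P))

namespace Design

/-- The set of free variables. -/
def fv (T : Design S) : Set ℕ := {x | FreeIn x T}

def Closed (T : Design S) : Prop := T.fv = ∅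

/-- A cut is a positive c-design `(∑ a(x⃗_a).P_a) | ā⟨N₁,…,N_k⟩`. -/
def IsCut (T : Design S) : Prop :=
  ∃ (a : S.Name) (P : S.Name → Pos S) (N : Fin (S.ar a) → Neg S),
    T = pos (Pos.act a (NegF.sum P) N)

def CutFree (T : Design S) : Prop := ∀ U, Subdesign U T → ¬ U.IsCut

/-- `T` is not a variable, and no argument of a positive action in `T` is a variable. -/
def IdentityFree (T : Design S) : Prop :=
  (∀ x, T ≠ neg (NegF.var x)) ∧
  ∀ (a : S.Name) (N₀ : Neg S) (N : Fin (S.ar a) → Neg S),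
    Subdesign (pos (Pos.act a N₀ N)) T → ∀ l x, N l ≠ NegF.var x

def Total (T : Design S) : Prop := T ≠ pos Pos.omega

/-- For every subdesign `N₀ | ā⟨N₁,…,N_k⟩` the sets of free variables of `N₀, N₁, …, N_k` are
pairwise disjoint. -/
def Linear (T : Design S) : Prop :=
  ∀ (a : S.Name) (N₀ : Neg S) (N : Fin (S.ar a) → Neg S),
    Subdesign (pos (Pos.act a N₀ N)) T →
      (∀ l, Disjoint (neg N₀).fv (neg (N l)).fv) ∧
      ∀ l m, l ≠ m → Disjoint (neg (N l)).fv (neg (N m)).fv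

structure Standard (T : Design S) : Prop where
  cutFree : T.CutFree
  identityFree : T.IdentityFree
  total : T.Total
  linear : T.Linear
  finite_fv : T.fv.Finite

/-- A positive c-design is atomic if its only possible free variable is `x₀`, a negative one if it
is closed. -/
def Atomic : Design S → Prop
  | pos P => (pos P).fv ⊆ {0}
  | neg N => (neg N).fv = ∅

end Design

/-! ### Reduction and orthogonality -/

/-- Cut reduction `(∑ a(x⃗_a).P_a) | ā⟨N⃗⟩ ⟶ P_a[N⃗ / x⃗_a]`. -/
inductive Step : Pos S → Pos S → Prop
  | cut (a : S.Name) (P : S.Name → Pos S) (N : Fin (S.ar a) → Neg S) :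
      Step (Pos.act a (NegF.sum P) N) ((P a).subst (instantiate N))

/-- `P ⇓ Q`. -/
def Evaluates (P Q : Pos S) : Prop :=
  Relation.ReflTransGen Step P Q ∧ ¬ (Design.pos Q).IsCut ∧ Q ≠ Pos.omega

/-- `P` converges to the daimon, that is, the normal form of `P` is the daimon: `P ⇓ ✠`. -/
def Converges (P : Pos S) : Prop := Evaluates P Pos.daimon

/-- Orthogonality of atomic c-designs: `P[N / x₀]` is closed and converges to the daimon. -/
def Orth (P : Pos S) (N : Neg S) : Prop :=
  (Design.pos (P.subst (single N))).Closed ∧ Converges (P.subst (single N))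

/-- `𝐓^⊥` for a set `𝐓` of atomic positive c-designs. -/
def orthPos (T : Set (Pos S)) : Set (Neg S) :=
  {N | (Design.neg N).Standard ∧ (Design.neg N).Atomic ∧ ∀ P ∈ T, Orth P N}

/-- `𝐓^⊥` for a set `𝐓` of atomic negative c-designs. -/
def orthNeg (T : Set (Neg S)) : Set (Pos S) :=
  {P | (Design.pos P).Standard ∧ (Design.pos P).Atomic ∧ ∀ N ∈ T, Orth P N}

/-- A positive a-behaviour: a set of standard atomic positive c-designs with `𝐏 = 𝐏^⊥⊥`. -/
def IsPosABehaviour (B : Set (Pos S)) : Prop :=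
  (∀ P ∈ B, (Design.pos P).Standard ∧ (Design.pos P).Atomic) ∧ B = orthNeg (orthPos B)

/-- A negative a-behaviour: a set of standard atomic negative c-designs with `𝐍 = 𝐍^⊥⊥`. -/
def IsNegABehaviour (B : Set (Neg S)) : Prop :=
  (∀ N ∈ B, (Design.neg N).Standard ∧ (Design.neg N).Atomic) ∧ B = orthPos (orthNeg B)

/-- An anti-design against positives, `[N₁ / x₁, …, N_n / x_n]` with base `{x₁, …, x_n}`. -/
structure AntiDesign (S : Signature.{u}) where
  base : Finset ℕ
  design : base → Neg S
  atomic : ∀ x, (Design.neg (design x)).Atomic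

namespace AntiDesign

/-- The substitution given by an anti-design. -/
def toSubst (G : AntiDesign S) (x : ℕ) : Neg S :=
  if h : x ∈ G.base then G.design ⟨x, h⟩ else NegF.var x

/-- `P ⊥ [G]`: `P[N₁ / x₁, …, N_n / x_n]` is closed and converges to the daimon. -/
def Orth (P : Pos S) (G : AntiDesign S) : Prop :=
  (Design.pos (P.subst G.toSubst)).Closed ∧ Converges (P.subst G.toSubst)

/-- `𝒢^⊥` for a set `𝒢` of anti-designs against positives. -/
def orthSet (𝒢 : Set (AntiDesign S)) : Set (Pos S) :=
  {P | (Design.pos P).Standard ∧ ∀ G ∈ 𝒢, Orth P G}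

/-- The set `[𝐍₁ / x₁, …, 𝐍_k / x_k]` of all `[N₁ / x₁, …, N_k / x_k]` with `N_i ∈ 𝐍_i`, for
the variables `x₁, …, x_k` with the indices `0, …, k-1`. -/
def family {k : ℕ} (N : Fin k → Set (Neg S)) : Set (AntiDesign S) :=
  {G | ∃ h : G.base = Finset.range k,
    ∀ l : Fin k, G.design ⟨l, by rw [h]; exact Finset.mem_range.2 l.2⟩ ∈ N l}

end AntiDesign

/-! ### Connectives -/

/-- A proper negative action `a(x₁,…,x_k)` with distinct variables among `z₁, …, z_n`; the variable
`z_j` is represented by `j`. -/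
structure NegAction (S : Signature.{u}) (n : ℕ) where
  name : S.Name
  vars : Fin (S.ar name) ↪ Fin n

/-- An `n`-ary connective `(z⃗, α^I, α^E)`, up to renaming of the bound variables `z⃗`. -/
structure Connective (S : Signature.{u}) (n : ℕ) where
  intro : Set (NegAction S n)
  elim : Set (NegAction S n)
  finite_intro : intro.Finite
  finite_elim : elim.Finite
  name_injOn : Set.InjOn NegAction.name (intro ∪ elim)
  covers : ∀ j : Fin n, ∃ p ∈ intro ∪ elim, j ∈ Set.range p.vars

/-- `ā⟨𝐍₁,…,𝐍_k⟩`: all `x₀ | ā⟨N₁,…,N_k⟩` with `N_i ∈ 𝐍_i`. -/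
def actSet (a : S.Name) (N : Fin (S.ar a) → Set (Neg S)) : Set (Pos S) :=
  {P | ∃ M : Fin (S.ar a) → Neg S, (∀ l, M l ∈ N l) ∧ P = Pos.act a (NegF.var 0) M}

namespace Connective

variable {n : ℕ}

/-- `α^E⟨𝐍₁,…,𝐍_n⟩ = (⋃ ā_i⟨𝐍_{(i,1)},…,𝐍_{(i,k)}⟩)^⊥⊥`, over `a_i(x⃗_i)` in `α^E`. -/
def elimBehaviour (α : Connective S n) (N : Fin n → Set (Neg S)) : Set (Pos S) :=
  orthNeg (orthPos (⋃ p ∈ α.elim, actSet p.name fun l => N (p.vars l)))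

/-- `α^I(𝐏₁,…,𝐏_n) = ⋂ ā_i⟨𝐏^⊥_{(i,1)},…,𝐏^⊥_{(i,k)}⟩^⊥`, over `a_i(x⃗_i)` in `α^I`; the
intersection is taken among the standard atomic negative c-designs. -/
def introBehaviour (α : Connective S n) (P : Fin n → Set (Pos S)) : Set (Neg S) :=
  {N | (Design.neg N).Standard ∧ (Design.neg N).Atomic ∧
    ∀ p ∈ α.intro, N ∈ orthPos (actSet p.name fun l => orthPos (P (p.vars l)))}

/-- The counter set `α^I(𝐏₁,…,𝐏_n)^C = ⋃ ā_i⟨𝐏^⊥_{(i,1)},…,𝐏^⊥_{(i,k)}⟩`, over `a_i(x⃗_i)` in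
`α^I`. -/
def introCounterSet (α : Connective S n) (P : Fin n → Set (Pos S)) : Set (Pos S) :=
  ⋃ p ∈ α.intro, actSet p.name fun l => orthPos (P (p.vars l))

def Inversion (α : Connective S n) : Prop := α.elim ⊆ α.intro

def Recovery (α : Connective S n) : Prop := α.intro ⊆ α.elim

/-- The harmony condition. -/
def Harmony (α : Connective S n) : Prop := α.Inversion ∧ α.Recovery

/-- Dual decomposability.  In the second condition `∑ a(x⃗_a).P_a` is a standard atomic c-design,
since these are the c-designs among which negative a-behaviours are formed. -/
def DuallyDecomposable (α : Connective S n) : Prop :=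
  (∀ N : Fin n → Set (Neg S), (∀ j, IsNegABehaviour (N j)) →
    α.elimBehaviour N = α.introCounterSet (fun j => orthNeg (N j)) ∪ {Pos.daimon}) ∧
  (∀ P : Fin n → Set (Pos S), (∀ j, IsPosABehaviour (P j)) →
    ∀ Q : S.Name → Pos S,
      (Design.neg (NegF.sum Q)).Standard → (Design.neg (NegF.sum Q)).Atomic →
      (NegF.sum Q ∈ α.introBehaviour P ↔
        ∀ p ∈ α.elim,
          Q p.name ∈ AntiDesign.orthSet (AntiDesign.family fun l => orthPos (P (p.vars l)))))

end Connective

end Ludics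

/-!
Cutting `x₀ | ā⟨M₁,…,M_k⟩` against a closed sum `∑ a(x⃗_a).Q_a` reduces in one step to
`Q_a[M⃗ / x⃗_a]`.  Hence orthogonality to `ā⟨𝐍₁,…,𝐍_k⟩` constrains the branch `Q_a` alone, and this
constraint is `Q_a ∈ [𝐍⃗ / x⃗_a]^⊥`.

A member of `(⋃ ā_i⟨𝐍⃗_i⟩)^⊥⊥` other than `✠` has the form `x₀ | ā⟨M₁,…,M_k⟩`.  It is analysed by
cutting it against sums in which all branches but one are `✠`.  With `Ω` in the branch `a` such a
sum is orthogonal to the union unless `a` is one of the `a_i`, so `a` is one of them.  With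
`R[x_l / x₀]` in the branch `a_i`, where `R ∈ 𝐍_{(i,l)}^⊥`, it is orthogonal to the union, and its
cut with the given member reduces to `R[M_l / x₀]`; therefore `M_l ∈ 𝐍_{(i,l)}^⊥⊥ = 𝐍_{(i,l)}`.
-/

namespace Ludics

variable {S : Signature.{u}}

/-! ### The final coalgebra of positive c-designs -/

namespace Pos

theorem eq_of_bisim (r : Pos S → Pos S → Prop)
    (h : ∀ P Q, r P Q → P.dest.map (Quot.mk r) = Q.dest.map (Quot.mk r)) {P Q : Pos S}
    (hPQ : r P Q) : P = Q :=
  QPF.Cofix.bisim_rel r h P Q hPQ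

theorem dest_injective : Function.Injective (dest : Pos S → PosF S (Pos S)) :=
  Function.LeftInverse.injective mk_dest

@[simp] theorem dest_daimon : (daimon : Pos S).dest = .daimon := dest_mk _

@[simp] theorem dest_omega : (omega : Pos S).dest = .omega := dest_mk _

@[simp] theorem dest_act (a : S.Name) (N₀ : Neg S) (N : Fin (S.ar a) → Neg S) :
    (act a N₀ N).dest = .act a N₀ N := dest_mk _

@[elab_as_elim]
theorem cases {motive : Pos S → Prop} (daimon : motive Pos.daimon) (omega : motive Pos.omega)
    (act : ∀ a N₀ N, motive (Pos.act a N₀ N)) (P : Pos S) : motive P := by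
  rw [← mk_dest P]
  cases P.dest with
  | daimon => exact daimon
  | omega => exact omega
  | act a N₀ N => exact act a N₀ N

theorem act_inj {a b : S.Name} {N₀ M₀ : Neg S} {N : Fin (S.ar a) → Neg S}
    {M : Fin (S.ar b) → Neg S} : act a N₀ N = act b M₀ M ↔ a = b ∧ N₀ = M₀ ∧ N ≍ M := by
  rw [← dest_injective.eq_iff, dest_act, dest_act, PosF.act.injEq]

@[simp] theorem daimon_ne_omega : (daimon : Pos S) ≠ omega :=
  dest_injective.ne_iff.1 (by simp)

@[simp] theorem daimon_ne_act (a : S.Name) (N₀ : Neg S) (N : Fin (S.ar a) → Neg S) :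
    daimon ≠ act a N₀ N :=
  dest_injective.ne_iff.1 (by simp)

@[simp] theorem omega_ne_act (a : S.Name) (N₀ : Neg S) (N : Fin (S.ar a) → Neg S) :
    omega ≠ act a N₀ N :=
  dest_injective.ne_iff.1 (by simp)

@[simp] theorem act_ne_daimon (a : S.Name) (N₀ : Neg S) (N : Fin (S.ar a) → Neg S) :
    act a N₀ N ≠ daimon :=
  (daimon_ne_act a N₀ N).symm

@[simp] theorem act_ne_omega (a : S.Name) (N₀ : Neg S) (N : Fin (S.ar a) → Neg S) :
    act a N₀ N ≠ omega :=
  (omega_ne_act a N₀ N).symm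

end Pos

/-! ### Free variables -/

theorem freeIn_pos_iff {x : ℕ} {P : Pos S} :
    FreeIn x (.pos P) ↔ ∃ a N₀ N, P = Pos.act a N₀ N ∧
      (FreeIn x (.neg N₀) ∨ ∃ l, FreeIn x (.neg (N l))) := by
  constructor
  · rintro (_ | h | ⟨l, h⟩)
    · exact ⟨_, _, _, rfl, .inl h⟩
    · exact ⟨_, _, _, rfl, .inr ⟨l, h⟩⟩
  · rintro ⟨a, N₀, N, rfl, h | ⟨l, h⟩⟩
    · exact .head h
    · exact .arg l h

namespace Design

@[simp] theorem fv_daimon : (pos (Pos.daimon : Pos S)).fv = ∅ := by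
  ext x
  simp [fv, freeIn_pos_iff]

@[simp] theorem fv_omega : (pos (Pos.omega : Pos S)).fv = ∅ := by
  ext x
  simp [fv, freeIn_pos_iff]

@[simp] theorem fv_act (a : S.Name) (N₀ : Neg S) (N : Fin (S.ar a) → Neg S) :
    (pos (Pos.act a N₀ N)).fv = (neg N₀).fv ∪ ⋃ l, (neg (N l)).fv := by
  ext x
  simp only [fv, Set.mem_ofPred_eq, Set.mem_union, Set.mem_iUnion]
  constructor
  · intro h
    obtain ⟨b, M₀, M, hM, h⟩ := freeIn_pos_iff.1 h
    obtain ⟨rfl, rfl, hNM⟩ := Pos.act_inj.1 hM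
    rwa [eq_of_heq hNM]
  · exact fun h => freeIn_pos_iff.2 ⟨a, N₀, N, rfl, h⟩

@[simp] theorem fv_var (x : ℕ) : (neg (NegF.var x : Neg S)).fv = {x} := by
  ext y
  refine ⟨fun h => ?_, fun h => h ▸ .var x⟩
  cases h
  rfl

theorem sub_ar_mem_fv_sum {P : S.Name → Pos S} {a : S.Name} {x : ℕ} (hx : x ∈ (pos (P a)).fv)
    (hax : S.ar a ≤ x) : x - S.ar a ∈ (neg (NegF.sum P)).fv :=
  .branch a (by rwa [Nat.add_sub_cancel' hax])

theorem closed_sum_iff {P : S.Name → Pos S} :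
    (neg (NegF.sum P)).Closed ↔ ∀ a, (pos (P a)).fv ⊆ Set.Iio (S.ar a) := by
  refine ⟨fun h a x hx => ?_, fun h => Set.eq_empty_iff_forall_notMem.2 ?_⟩
  · by_contra hax
    exact Set.eq_empty_iff_forall_notMem.1 h _ (sub_ar_mem_fv_sum hx (not_lt.1 hax))
  · rintro x (_ | _ | _ | ⟨a, hx⟩)
    exact absurd (h a hx) (by simp)

end Design

/-! ### Renaming -/

theorem liftRen_injective (k : ℕ) {ρ : ℕ → ℕ} (hρ : Function.Injective ρ) :
    Function.Injective (liftRen k ρ) := by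
  intro i j h
  unfold liftRen at h
  split_ifs at h with hi hj hj
  · exact h
  · omega
  · omega
  · have := hρ (Nat.add_right_cancel h)
    omega

@[simp] theorem NegF.rename_var (ρ : ℕ → ℕ) (x : ℕ) :
    (var x : Neg S).rename ρ = var (ρ x) := rfl

theorem NegF.rename_sum (ρ : ℕ → ℕ) (P : S.Name → Pos S) :
    (sum P : Neg S).rename ρ = sum fun a => (P a).rename (liftRen (S.ar a) ρ) := rfl

namespace Pos

theorem dest_rename (ρ : ℕ → ℕ) (P : Pos S) :
    (P.rename ρ).dest = (P.dest.renameStep ρ).map fun s => s.2.rename s.1 :=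
  dest_corec _ _

@[simp] theorem rename_daimon (ρ : ℕ → ℕ) : (daimon : Pos S).rename ρ = daimon :=
  dest_injective (by rw [dest_rename, dest_daimon]; rfl)

@[simp] theorem rename_omega (ρ : ℕ → ℕ) : (omega : Pos S).rename ρ = omega :=
  dest_injective (by rw [dest_rename, dest_omega]; rfl)

@[simp] theorem rename_act (ρ : ℕ → ℕ) (a : S.Name) (N₀ : Neg S) (N : Fin (S.ar a) → Neg S) :
    (act a N₀ N).rename ρ = act a (N₀.rename ρ) fun l => (N l).rename ρ :=
  dest_injective (by rw [dest_rename, dest_act, dest_act]; rfl)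

end Pos

namespace Design

/-- Renaming of the free variables of a c-design of either polarity, so that the two polarities can
be treated in a single induction. -/
def rename (ρ : ℕ → ℕ) : Design S → Design S
  | pos P => pos (P.rename ρ)
  | neg N => neg (N.rename ρ)

theorem exists_of_rename_eq_act {ρ : ℕ → ℕ} {T : Design S} {a : S.Name} {M₀ : Neg S}
    {M : Fin (S.ar a) → Neg S} (h : T.rename ρ = pos (Pos.act a M₀ M)) :
    ∃ N₀ N, T = pos (Pos.act a N₀ N) ∧ N₀.rename ρ = M₀ ∧ (fun l => (N l).rename ρ) = M := by
  rcases T with P | N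
  · have hP := pos.inj h
    cases P using Pos.cases with
    | daimon => simp at hP
    | omega => simp at hP
    | act b N₀ N =>
      rw [Pos.rename_act] at hP
      obtain ⟨rfl, hN₀, hN⟩ := Pos.act_inj.1 hP
      exact ⟨N₀, N, rfl, hN₀, eq_of_heq hN⟩
  · cases h

theorem exists_of_rename_eq_sum {ρ : ℕ → ℕ} {T : Design S} {Q : S.Name → Pos S}
    (h : T.rename ρ = neg (NegF.sum Q)) :
    ∃ P, T = neg (NegF.sum P) ∧ (fun a => (P a).rename (liftRen (S.ar a) ρ)) = Q := by
  rcases T with P | (x | P) <;> cases h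
  exact ⟨P, rfl, rfl⟩

theorem exists_of_rename_eq_var {ρ : ℕ → ℕ} {T : Design S} {x : ℕ}
    (h : T.rename ρ = neg (NegF.var x)) : ∃ y, T = neg (NegF.var y) ∧ ρ y = x := by
  rcases T with P | (y | P) <;> cases h
  exact ⟨y, rfl, rfl⟩

theorem fv_rename_subset (ρ : ℕ → ℕ) (T : Design S) : (T.rename ρ).fv ⊆ ρ '' T.fv := by
  intro x (hx : FreeIn x (T.rename ρ))
  generalize hU : T.rename ρ = U at hx
  induction hx generalizing ρ T with
  | var x =>
    obtain ⟨y, rfl, rfl⟩ := exists_of_rename_eq_var hU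
    exact ⟨y, .var y, rfl⟩
  | head _ ih =>
    obtain ⟨N₀, N, rfl, rfl, -⟩ := exists_of_rename_eq_act hU
    obtain ⟨y, hy, rfl⟩ := ih ρ (neg N₀) rfl
    exact ⟨y, .head hy, rfl⟩
  | arg l _ ih =>
    obtain ⟨N₀, N, rfl, -, rfl⟩ := exists_of_rename_eq_act hU
    obtain ⟨y, hy, rfl⟩ := ih ρ (neg (N l)) rfl
    exact ⟨y, .arg l hy, rfl⟩
  | branch a _ ih =>
    obtain ⟨P, rfl, rfl⟩ := exists_of_rename_eq_sum hU
    obtain ⟨y, hy, hyx⟩ := ih (liftRen (S.ar a) ρ) (pos (P a)) rfl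
    unfold liftRen at hyx
    split_ifs at hyx with hya
    · omega
    · exact ⟨y - S.ar a, sub_ar_mem_fv_sum hy (not_lt.1 hya), by omega⟩

end Design

/-! ### Substitution -/

/-- Simultaneous substitution in a negative c-design, the companion of `Pos.subst`. -/
def NegF.subst (σ : ℕ → Neg S) (N : Neg S) : Neg S := (N.substStep σ).map fun s => s.2.subst s.1

theorem NegF.subst_sum (σ : ℕ → Neg S) (P : S.Name → Pos S) :
    (sum P : Neg S).subst σ = sum fun a => (P a).subst (liftSubst (S.ar a) σ) := rfl

theorem liftSubst_var (k : ℕ) : liftSubst k (NegF.var : ℕ → Neg S) = NegF.var := by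
  funext i
  unfold liftSubst
  split_ifs with h
  · rfl
  · rw [NegF.rename_var, Nat.sub_add_cancel (not_lt.1 h)]

theorem liftSubst_comp_liftRen (k : ℕ) (σ : ℕ → Neg S) (ρ : ℕ → ℕ) :
    liftSubst k σ ∘ liftRen k ρ = liftSubst k (σ ∘ ρ) := by
  funext i
  simp only [Function.comp_apply, liftSubst, liftRen]
  split_ifs <;> simp_all

theorem liftSubst_eqOn {σ τ : ℕ → Neg S} {P : S.Name → Pos S}
    (h : Set.EqOn σ τ (Design.neg (NegF.sum P)).fv) (a : S.Name) :
    Set.EqOn (liftSubst (S.ar a) σ) (liftSubst (S.ar a) τ) (Design.pos (P a)).fv := by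
  intro x hx
  unfold liftSubst
  split_ifs with hxa
  · rfl
  · rw [h (Design.sub_ar_mem_fv_sum hx (not_lt.1 hxa))]

namespace Pos

theorem dest_subst (σ : ℕ → Neg S) (P : Pos S) :
    (P.subst σ).dest = (P.dest.substStep σ).map fun s => s.2.subst s.1 :=
  dest_corec _ _

@[simp] theorem subst_daimon (σ : ℕ → Neg S) : (daimon : Pos S).subst σ = daimon :=
  dest_injective (by rw [dest_subst, dest_daimon]; rfl)

@[simp] theorem subst_omega (σ : ℕ → Neg S) : (omega : Pos S).subst σ = omega :=
  dest_injective (by rw [dest_subst, dest_omega]; rfl)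

@[simp] theorem subst_act (σ : ℕ → Neg S) (a : S.Name) (N₀ : Neg S)
    (N : Fin (S.ar a) → Neg S) :
    (act a N₀ N).subst σ = act a (N₀.subst σ) fun l => (N l).subst σ :=
  dest_injective (by rw [dest_subst, dest_act, dest_act]; rfl)

theorem subst_id (P : Pos S) : P.subst NegF.var = P := by
  let r (P Q : Pos S) : Prop := P = Q.subst NegF.var
  refine eq_of_bisim r ?_ rfl
  rintro _ P rfl
  have hneg (N : Neg S) : (N.subst NegF.var).map (Quot.mk r) = N.map (Quot.mk r) := by
    cases N with
    | var x => rfl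
    | sum P =>
      rw [NegF.subst_sum]
      exact congrArg NegF.sum (funext fun a =>
        Quot.sound (congrArg (Pos.subst · (P a)) (liftSubst_var _)))
  cases P using Pos.cases with
  | daimon => rw [subst_daimon]
  | omega => rw [subst_omega]
  | act a N₀ N => simp only [subst_act, dest_act, PosF.map, hneg]

end Pos

theorem NegF.subst_id (N : Neg S) : N.subst var = N := by
  cases N with
  | var x => rfl
  | sum P => simp only [subst_sum, liftSubst_var, Pos.subst_id]

@[simp] theorem NegF.subst_var (σ : ℕ → Neg S) (x : ℕ) : (var x : Neg S).subst σ = σ x := by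
  change ((σ x).map fun P => ((var : ℕ → Neg S), P)).map (fun s => s.2.subst s.1) = σ x
  cases σ x with
  | var y => rfl
  | sum P => exact congrArg sum (funext fun a => (P a).subst_id)

theorem Pos.subst_congr {σ τ : ℕ → Neg S} {P : Pos S} (h : Set.EqOn σ τ (Design.pos P).fv) :
    P.subst σ = P.subst τ := by
  let r (P Q : Pos S) : Prop :=
    ∃ T σ τ, Set.EqOn σ τ (Design.pos T).fv ∧ P = T.subst σ ∧ Q = T.subst τ
  refine eq_of_bisim r ?_ ⟨P, σ, τ, h, rfl, rfl⟩
  rintro _ _ ⟨P, σ, τ, h, rfl, rfl⟩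
  have hneg (N : Neg S) (h : Set.EqOn σ τ (Design.neg N).fv) :
      (N.subst σ).map (Quot.mk r) = (N.subst τ).map (Quot.mk r) := by
    cases N with
    | var x => rw [NegF.subst_var, NegF.subst_var, h (.var x)]
    | sum P =>
      exact congrArg NegF.sum (funext fun a =>
        Quot.sound ⟨P a, _, _, liftSubst_eqOn h a, rfl, rfl⟩)
  cases P using Pos.cases with
  | daimon => rw [subst_daimon, subst_daimon]
  | omega => rw [subst_omega, subst_omega]
  | act a N₀ N =>
    simp only [subst_act, dest_act, PosF.map, hneg N₀ fun _ hx => h (.head hx),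
      fun l => hneg (N l) fun _ hx => h (.arg l hx)]

theorem NegF.subst_congr {σ τ : ℕ → Neg S} {N : Neg S} (h : Set.EqOn σ τ (Design.neg N).fv) :
    N.subst σ = N.subst τ := by
  cases N with
  | var x => rw [subst_var, subst_var, h (.var x)]
  | sum P => exact congrArg sum (funext fun a => Pos.subst_congr (liftSubst_eqOn h a))

theorem NegF.subst_of_closed {N : Neg S} (h : (Design.neg N).Closed) (σ : ℕ → Neg S) :
    N.subst σ = N := by
  have hσ : Set.EqOn σ var (Design.neg N).fv := by
    rw [show (Design.neg N).fv = ∅ from h]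
    exact Set.eqOn_empty σ var
  rw [subst_congr hσ, subst_id]

theorem Pos.subst_rename (σ : ℕ → Neg S) (ρ : ℕ → ℕ) (P : Pos S) :
    (P.rename ρ).subst σ = P.subst (σ ∘ ρ) := by
  let r (P Q : Pos S) : Prop := ∃ (T : Pos S) (σ : ℕ → Neg S) (ρ : ℕ → ℕ),
    P = (T.rename ρ).subst σ ∧ Q = T.subst (σ ∘ ρ)
  refine eq_of_bisim r ?_ ⟨P, σ, ρ, rfl, rfl⟩
  rintro _ _ ⟨P, σ, ρ, rfl, rfl⟩
  have hneg (N : Neg S) :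
      ((N.rename ρ).subst σ).map (Quot.mk r) = (N.subst (σ ∘ ρ)).map (Quot.mk r) := by
    cases N with
    | var x => rw [NegF.rename_var, NegF.subst_var, NegF.subst_var, Function.comp_apply]
    | sum P =>
      rw [NegF.rename_sum, NegF.subst_sum, NegF.subst_sum]
      exact congrArg NegF.sum (funext fun a =>
        Quot.sound ⟨P a, _, _, rfl, by rw [liftSubst_comp_liftRen]⟩)
  cases P using Pos.cases with
  | daimon => rw [rename_daimon, subst_daimon, subst_daimon]
  | omega => rw [rename_omega, subst_omega, subst_omega]
  | act a N₀ N => simp only [rename_act, subst_act, dest_act, PosF.map, hneg]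

namespace Design

/-- Substitution in a c-design of either polarity, so that the two polarities can be treated in a
single induction. -/
def subst (σ : ℕ → Neg S) : Design S → Design S
  | pos P => pos (P.subst σ)
  | neg N => neg (N.subst σ)

theorem exists_of_subst_eq_act {σ : ℕ → Neg S} {T : Design S} {a : S.Name} {M₀ : Neg S}
    {M : Fin (S.ar a) → Neg S} (h : T.subst σ = pos (Pos.act a M₀ M)) :
    ∃ N₀ N, T = pos (Pos.act a N₀ N) ∧ N₀.subst σ = M₀ ∧ (fun l => (N l).subst σ) = M := by
  rcases T with P | N
  · have hP := pos.inj h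
    cases P using Pos.cases with
    | daimon => simp at hP
    | omega => simp at hP
    | act b N₀ N =>
      rw [Pos.subst_act] at hP
      obtain ⟨rfl, hN₀, hN⟩ := Pos.act_inj.1 hP
      exact ⟨N₀, N, rfl, hN₀, eq_of_heq hN⟩
  · cases h

theorem mem_fv_sum_of_mem_fv_liftSubst {σ : ℕ → Neg S} {P : S.Name → Pos S} {a : S.Name}
    {x y : ℕ} (hy : y ∈ (pos (P a)).fv) (hx : S.ar a + x ∈ (neg (liftSubst (S.ar a) σ y)).fv) :
    ∃ z ∈ (neg (NegF.sum P)).fv, x ∈ (neg (σ z)).fv := by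
  unfold liftSubst at hx
  split_ifs at hx with hya
  · rw [fv_var, Set.mem_singleton_iff] at hx
    omega
  · obtain ⟨w, hw, hwx⟩ := fv_rename_subset (· + S.ar a) (neg (σ (y - S.ar a))) hx
    obtain rfl : w = x := Nat.add_left_cancel ((Nat.add_comm _ _).trans hwx)
    exact ⟨y - S.ar a, sub_ar_mem_fv_sum hy (not_lt.1 hya), hw⟩

theorem fv_subst_subset (σ : ℕ → Neg S) (T : Design S) :
    (T.subst σ).fv ⊆ ⋃ y ∈ T.fv, (neg (σ y)).fv := by
  intro x (hx : FreeIn x (T.subst σ))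
  rw [Set.mem_iUnion₂]
  simp only [exists_prop]
  generalize hU : T.subst σ = U at hx
  induction hx generalizing σ T with
  | var x =>
    rcases T with P | (y | P)
    · cases hU
    · refine ⟨y, .var y, ?_⟩
      rw [← NegF.subst_var σ y, neg.inj hU]
      exact .var x
    · cases hU
  | head _ ih =>
    obtain ⟨N₀, N, rfl, rfl, -⟩ := exists_of_subst_eq_act hU
    obtain ⟨y, hy, hxy⟩ := ih σ (neg N₀) rfl
    exact ⟨y, .head hy, hxy⟩
  | arg l _ ih =>
    obtain ⟨N₀, N, rfl, -, rfl⟩ := exists_of_subst_eq_act hU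
    obtain ⟨y, hy, hxy⟩ := ih σ (neg (N l)) rfl
    exact ⟨y, .arg l hy, hxy⟩
  | branch a hx ih =>
    rcases T with P | (y | P)
    · cases hU
    · refine ⟨y, .var y, ?_⟩
      rw [← NegF.subst_var σ y, neg.inj hU]
      exact .branch a hx
    · obtain rfl := NegF.sum.inj (neg.inj hU)
      obtain ⟨y, hy, hxy⟩ := ih (liftSubst (S.ar a) σ) (pos (P a)) rfl
      exact mem_fv_sum_of_mem_fv_liftSubst hy hxy

theorem closed_subst {σ : ℕ → Neg S} {P : Pos S}
    (h : ∀ x ∈ (pos P).fv, (neg (σ x)).Closed) : (pos (P.subst σ)).Closed := by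
  refine Set.subset_empty_iff.1 ((fv_subst_subset σ (pos P)).trans ?_)
  exact Set.iUnion₂_subset fun x hx => (h x hx).subset

end Design

/-! ### Standard c-designs -/

theorem Subdesign.trans {U V W : Design S} (hUV : Subdesign U V) (hVW : Subdesign V W) :
    Subdesign U W := by
  induction hVW with
  | refl => exact hUV
  | head _ ih => exact .head ih
  | arg l _ ih => exact .arg l ih
  | branch a _ ih => exact .branch a ih

theorem subdesign_pos_iff {U : Design S} {P : Pos S} :
    Subdesign U (.pos P) ↔ U = .pos P ∨ ∃ a N₀ N, P = Pos.act a N₀ N ∧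
      (Subdesign U (.neg N₀) ∨ ∃ l, Subdesign U (.neg (N l))) := by
  constructor
  · rintro (_ | h | ⟨l, h⟩)
    · exact .inl rfl
    · exact .inr ⟨_, _, _, rfl, .inl h⟩
    · exact .inr ⟨_, _, _, rfl, .inr ⟨l, h⟩⟩
  · rintro (rfl | ⟨a, N₀, N, rfl, h | ⟨l, h⟩⟩)
    · exact .refl
    · exact .head h
    · exact .arg l h

theorem Subdesign.exists_of_rename {ρ : ℕ → ℕ} (hρ : Function.Injective ρ) {T U : Design S}
    (h : Subdesign U (T.rename ρ)) :
    ∃ (ρ' : ℕ → ℕ) (V : Design S), Function.Injective ρ' ∧ Subdesign V T ∧ V.rename ρ' = U := by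
  generalize hW : T.rename ρ = W at h
  induction h generalizing ρ T with
  | refl => exact ⟨ρ, T, hρ, .refl, hW⟩
  | head _ ih =>
    obtain ⟨N₀, N, rfl, rfl, -⟩ := Design.exists_of_rename_eq_act hW
    obtain ⟨ρ', V, hρ', hV, rfl⟩ := ih hρ (T := .neg N₀) rfl
    exact ⟨ρ', V, hρ', .head hV, rfl⟩
  | arg l _ ih =>
    obtain ⟨N₀, N, rfl, -, rfl⟩ := Design.exists_of_rename_eq_act hW
    obtain ⟨ρ', V, hρ', hV, rfl⟩ := ih hρ (T := .neg (N l)) rfl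
    exact ⟨ρ', V, hρ', .arg l hV, rfl⟩
  | branch a _ ih =>
    obtain ⟨P, rfl, rfl⟩ := Design.exists_of_rename_eq_sum hW
    obtain ⟨ρ', V, hρ', hV, rfl⟩ := ih (liftRen_injective _ hρ) (T := .pos (P a)) rfl
    exact ⟨ρ', V, hρ', .branch a hV, rfl⟩

/-- The conditions that standardness imposes on a single positive action `N₀ | ā⟨N₁,…,N_k⟩`: it is
not a cut, no argument is a variable, and the immediate subdesigns share no free variable. -/
structure StandardAct {k : ℕ} (N₀ : Neg S) (N : Fin k → Neg S) : Prop where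
  head_eq_var : ∃ x, N₀ = NegF.var x
  arg_ne_var : ∀ l x, N l ≠ NegF.var x
  disjoint_head_arg : ∀ l, Disjoint (Design.neg N₀).fv (Design.neg (N l)).fv
  disjoint_args : ∀ l m, l ≠ m → Disjoint (Design.neg (N l)).fv (Design.neg (N m)).fv

theorem StandardAct.rename {k : ℕ} {N₀ : Neg S} {N : Fin k → Neg S} (h : StandardAct N₀ N)
    {ρ : ℕ → ℕ} (hρ : Function.Injective ρ) :
    StandardAct (N₀.rename ρ) fun l => (N l).rename ρ := by
  have hdisj {M M' : Neg S} (hMM' : Disjoint (Design.neg M).fv (Design.neg M').fv) :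
      Disjoint (Design.neg (M.rename ρ)).fv (Design.neg (M'.rename ρ)).fv :=
    ((Set.disjoint_image_iff hρ).2 hMM').mono (Design.fv_rename_subset ρ (.neg M))
      (Design.fv_rename_subset ρ (.neg M'))
  refine ⟨?_, fun l y hy => ?_, fun l => hdisj (h.disjoint_head_arg l),
    fun l m hlm => hdisj (h.disjoint_args l m hlm)⟩
  · obtain ⟨x, rfl⟩ := h.head_eq_var
    exact ⟨ρ x, rfl⟩
  · obtain ⟨z, hz, -⟩ := Design.exists_of_rename_eq_var (T := .neg (N l)) (congrArg _ hy)
    exact h.arg_ne_var l z (Design.neg.inj hz)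

namespace Design

/-- The part of standardness that passes to all subdesigns.  Unlike `Standard` it allows `T` to be
`Ω` or a variable, and so it holds of every branch of a standard sum. -/
def LocallyStandard (T : Design S) : Prop :=
  ∀ (a : S.Name) (N₀ : Neg S) (N : Fin (S.ar a) → Neg S),
    Subdesign (pos (Pos.act a N₀ N)) T → StandardAct N₀ N

theorem LocallyStandard.mono {T U : Design S} (h : T.LocallyStandard) (hUT : Subdesign U T) :
    U.LocallyStandard := fun a N₀ N hN => h a N₀ N (hN.trans hUT)

theorem standard_iff {T : Design S} :
    T.Standard ↔
      T.LocallyStandard ∧ (∀ x, T ≠ neg (NegF.var x)) ∧ T ≠ pos Pos.omega ∧ T.fv.Finite := by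
  constructor
  · refine fun h => ⟨fun a N₀ N hN => ⟨?_, h.identityFree.2 a N₀ N hN, (h.linear a N₀ N hN).1,
      (h.linear a N₀ N hN).2⟩, h.identityFree.1, h.total, h.finite_fv⟩
    cases N₀ with
    | var x => exact ⟨x, rfl⟩
    | sum P => exact absurd ⟨a, P, N, rfl⟩ (h.cutFree _ hN)
  · rintro ⟨h, hvar, hΩ, hfin⟩
    refine ⟨?_, ⟨hvar, fun a N₀ N hN => (h a N₀ N hN).arg_ne_var⟩, hΩ, fun a N₀ N hN =>
      ⟨(h a N₀ N hN).disjoint_head_arg, (h a N₀ N hN).disjoint_args⟩, hfin⟩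
    rintro _ hU ⟨a, P, N, rfl⟩
    obtain ⟨x, hx⟩ := (h a _ N hU).head_eq_var
    cases hx

theorem Standard.locallyStandard {T : Design S} (h : T.Standard) : T.LocallyStandard :=
  (standard_iff.1 h).1

theorem locallyStandard_daimon : (pos (Pos.daimon : Pos S)).LocallyStandard := by
  intro a N₀ N hN
  simp [subdesign_pos_iff] at hN

theorem locallyStandard_omega : (pos (Pos.omega : Pos S)).LocallyStandard := by
  intro a N₀ N hN
  simp [subdesign_pos_iff] at hN

theorem locallyStandard_var (x : ℕ) : (neg (NegF.var x : Neg S)).LocallyStandard := by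
  rintro a N₀ N ⟨⟩

theorem locallyStandard_act {a : S.Name} {N₀ : Neg S} {N : Fin (S.ar a) → Neg S}
    (h : StandardAct N₀ N) (h₀ : (neg N₀).LocallyStandard)
    (hN : ∀ l, (neg (N l)).LocallyStandard) : (pos (Pos.act a N₀ N)).LocallyStandard := by
  intro b M₀ M hM
  obtain hM | ⟨c, N₀', N', hNN', hM⟩ := subdesign_pos_iff.1 hM
  · obtain ⟨rfl, rfl, hMN⟩ := Pos.act_inj.1 (pos.inj hM)
    obtain rfl := eq_of_heq hMN
    exact h
  · obtain ⟨rfl, rfl, hargs⟩ := Pos.act_inj.1 hNN'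
    obtain rfl := eq_of_heq hargs
    obtain hM | ⟨l, hM⟩ := hM
    · exact h₀ b M₀ M hM
    · exact hN l b M₀ M hM

theorem locallyStandard_sum {P : S.Name → Pos S} (h : ∀ a, (pos (P a)).LocallyStandard) :
    (neg (NegF.sum P)).LocallyStandard := by
  rintro a N₀ N (_ | _ | _ | ⟨b, hN⟩)
  exact h b a N₀ N hN

theorem LocallyStandard.rename {T : Design S} (h : T.LocallyStandard) {ρ : ℕ → ℕ}
    (hρ : Function.Injective ρ) : (T.rename ρ).LocallyStandard := by
  intro a M₀ M hM
  obtain ⟨ρ', U, hρ', hU, hUM⟩ := hM.exists_of_rename hρ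
  obtain ⟨N₀, N, rfl, rfl, rfl⟩ := exists_of_rename_eq_act hUM
  exact (h a N₀ N hU).rename hρ'

theorem standard_sum {P : S.Name → Pos S} (h : ∀ a, (pos (P a)).LocallyStandard)
    (hc : (neg (NegF.sum P)).Closed) : (neg (NegF.sum P)).Standard :=
  standard_iff.2 ⟨locallyStandard_sum h, by simp, by simp, hc ▸ Set.finite_empty⟩

theorem standard_daimon : (pos (Pos.daimon : Pos S)).Standard :=
  standard_iff.2 ⟨locallyStandard_daimon, by simp, by simp, by simp⟩

theorem atomic_daimon : (pos (Pos.daimon : Pos S)).Atomic := by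
  simp [Atomic]

theorem atomic_act {a : S.Name} {N : Fin (S.ar a) → Neg S} (h : ∀ l, (neg (N l)).Closed) :
    (pos (Pos.act a (NegF.var 0) N)).Atomic := by
  simp [Atomic, fun l => show (neg (N l)).fv = ∅ from h l]

theorem standard_act {a : S.Name} {N : Fin (S.ar a) → Neg S}
    (h : ∀ l, (neg (N l)).Standard) (hc : ∀ l, (neg (N l)).Closed) :
    (pos (Pos.act a (NegF.var 0) N)).Standard := by
  have hfv (l) : (neg (N l)).fv = ∅ := hc l
  have hact : StandardAct (NegF.var 0) N :=
    ⟨⟨0, rfl⟩, fun l x hx => (h l).identityFree.1 x (congrArg _ hx), by simp [hfv], by simp [hfv]⟩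
  exact standard_iff.2 ⟨locallyStandard_act hact (locallyStandard_var 0)
    fun l => (h l).locallyStandard, by simp, by simp,
    (Set.finite_singleton 0).subset (atomic_act hc)⟩

theorem Standard.eq_daimon_or_act {P : Pos S} (h : (pos P).Standard) (ha : (pos P).Atomic) :
    P = Pos.daimon ∨ ∃ a N, P = Pos.act a (NegF.var 0) N ∧
      (∀ l, (neg (N l)).Standard) ∧ ∀ l, (neg (N l)).Closed := by
  cases P using Pos.cases with
  | daimon => exact .inl rfl
  | omega => exact absurd rfl h.total
  | act a N₀ N =>
    have hact : StandardAct N₀ N := h.locallyStandard a N₀ N .refl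
    obtain ⟨x, rfl⟩ := hact.head_eq_var
    obtain rfl : x = 0 := ha (.head (.var x))
    have hc (l) : (neg (N l)).fv = ∅ := by
      refine Set.eq_empty_iff_forall_notMem.2 fun y hy => ?_
      obtain rfl : y = 0 := ha (.arg l hy)
      exact Set.disjoint_left.1 (hact.disjoint_head_arg l) (.var 0) hy
    refine .inr ⟨a, N, rfl, fun l => standard_iff.2 ⟨h.locallyStandard.mono (.arg l .refl),
      fun x hx => hact.arg_ne_var l x (neg.inj hx), by simp, by simp [hc l]⟩, hc⟩

end Design

/-! ### Convergence and orthogonality -/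

theorem converges_daimon : Converges (Pos.daimon : Pos S) :=
  ⟨.refl, by simp [Design.IsCut], Pos.daimon_ne_omega⟩

theorem not_converges_omega : ¬ Converges (Pos.omega : Pos S) := by
  rintro ⟨h, -, -⟩
  obtain h | ⟨Q, h, -⟩ := h.cases_head
  · exact Pos.daimon_ne_omega h.symm
  · generalize hT : (Pos.omega : Pos S) = T at h
    cases h
    exact Pos.omega_ne_act _ _ _ hT

theorem step_cut_iff {a : S.Name} {P : S.Name → Pos S} {N : Fin (S.ar a) → Neg S} {Q : Pos S} :
    Step (Pos.act a (NegF.sum P) N) Q ↔ Q = (P a).subst (instantiate N) := by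
  refine ⟨fun h => ?_, fun h => h ▸ .cut a P N⟩
  generalize hT : Pos.act a (NegF.sum P) N = T at h
  cases h with
  | cut b P' N' =>
    obtain ⟨rfl, hP, hN⟩ := Pos.act_inj.1 hT
    obtain rfl := NegF.sum.inj hP
    obtain rfl := eq_of_heq hN
    rfl

theorem converges_cut_iff {a : S.Name} {P : S.Name → Pos S} {N : Fin (S.ar a) → Neg S} :
    Converges (Pos.act a (NegF.sum P) N) ↔ Converges ((P a).subst (instantiate N)) := by
  refine ⟨fun ⟨h, h'⟩ => ⟨?_, h'⟩, fun ⟨h, h'⟩ => ⟨.head (.cut a P N) h, h'⟩⟩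
  obtain h | ⟨Q, hQ, h⟩ := h.cases_head
  · exact absurd h.symm (Pos.daimon_ne_act _ _ _)
  · rwa [step_cut_iff.1 hQ] at h

theorem orth_iff_converges {P : Pos S} {N : Neg S} (hP : (Design.pos P).Atomic)
    (hN : (Design.neg N).Closed) : Orth P N ↔ Converges (P.subst (single N)) := by
  refine and_iff_right (Design.closed_subst fun x hx => ?_)
  obtain rfl : x = 0 := hP hx
  exact hN

theorem orth_daimon (N : Neg S) : Orth Pos.daimon N := by
  rw [Orth, Pos.subst_daimon]
  exact ⟨Design.fv_daimon, converges_daimon⟩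

theorem orth_act_sum_iff {a : S.Name} {M : Fin (S.ar a) → Neg S} {Q : S.Name → Pos S}
    (hM : ∀ l, (Design.neg (M l)).Closed) (hQ : (Design.neg (NegF.sum Q)).Closed) :
    Orth (Pos.act a (NegF.var 0) M) (NegF.sum Q) ↔ Converges ((Q a).subst (instantiate M)) := by
  have hcut : (Pos.act a (NegF.var 0) M).subst (single (NegF.sum Q)) =
      Pos.act a (NegF.sum Q) M := by
    simp only [Pos.subst_act, NegF.subst_var, single, if_pos, NegF.subst_of_closed (hM _)]
  rw [orth_iff_converges (Design.atomic_act hM) hQ, hcut, converges_cut_iff]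

theorem subset_orthNeg_orthPos {T : Set (Pos S)}
    (h : ∀ P ∈ T, (Design.pos P).Standard ∧ (Design.pos P).Atomic) : T ⊆ orthNeg (orthPos T) :=
  fun P hP => ⟨(h P hP).1, (h P hP).2, fun _ hN => hN.2.2 P hP⟩

theorem daimon_mem_orthNeg (T : Set (Neg S)) : Pos.daimon ∈ orthNeg T :=
  ⟨Design.standard_daimon, Design.atomic_daimon, fun N _ => orth_daimon N⟩

theorem orthPos_nonempty {T : Set (Pos S)}
    (h : ∀ P ∈ T, (Design.pos P).Standard ∧ (Design.pos P).Atomic) : (orthPos T).Nonempty := by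
  have hc : (Design.neg (NegF.sum fun _ => (Pos.daimon : Pos S))).Closed :=
    Design.closed_sum_iff.2 (by simp)
  refine ⟨NegF.sum fun _ => Pos.daimon,
    Design.standard_sum (fun _ => Design.locallyStandard_daimon) hc, hc, fun P hP => ?_⟩
  obtain rfl | ⟨a, N, rfl, -, hN⟩ := (h P hP).1.eq_daimon_or_act (h P hP).2
  · exact orth_daimon _
  · rw [orth_act_sum_iff hN hc, Pos.subst_daimon]
    exact converges_daimon

theorem mem_orthPos_biUnion_iff {ι : Type*} {s : Set ι} {T : ι → Set (Pos S)} {N : Neg S}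
    (hN : (Design.neg N).Standard) (hNc : (Design.neg N).Atomic) :
    N ∈ orthPos (⋃ i ∈ s, T i) ↔ ∀ i ∈ s, N ∈ orthPos (T i) := by
  simp only [orthPos, Set.mem_ofPred_eq, hN, hNc, true_and, Set.mem_iUnion₂]
  exact ⟨fun h i hi P hP => h P ⟨i, hi, hP⟩, fun h P ⟨i, hi, hP⟩ => h i hi P hP⟩

theorem sum_mem_orthPos_actSet_iff {a : S.Name} {N : Fin (S.ar a) → Set (Neg S)}
    (hN : ∀ l, ∀ M ∈ N l, (Design.neg M).Closed) {Q : S.Name → Pos S}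
    (hQ : (Design.neg (NegF.sum Q)).Standard) (hQc : (Design.neg (NegF.sum Q)).Closed) :
    NegF.sum Q ∈ orthPos (actSet a N) ↔
      ∀ M : Fin (S.ar a) → Neg S, (∀ l, M l ∈ N l) → Converges ((Q a).subst (instantiate M)) := by
  constructor
  · exact fun h M hM => (orth_act_sum_iff (fun l => hN l _ (hM l)) hQc).1 (h.2.2 _ ⟨M, hM, rfl⟩)
  · refine fun h => ⟨hQ, hQc, ?_⟩
    rintro _ ⟨M, hM, rfl⟩
    exact (orth_act_sum_iff (fun l => hN l _ (hM l)) hQc).2 (h M hM)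

/-! ### Orthogonality to anti-designs -/

namespace AntiDesign

/-- The anti-design `[M₁ / x₁, …, M_k / x_k]` for the variables with the indices `0, …, k-1`. -/
def ofFin {k : ℕ} (M : Fin k → Neg S) (hM : ∀ l, (Design.neg (M l)).Closed) : AntiDesign S where
  base := Finset.range k
  design x := M ⟨x, Finset.mem_range.1 x.2⟩
  atomic _ := hM _

theorem mem_family_iff {k : ℕ} {N : Fin k → Set (Neg S)} {G : AntiDesign S} :
    G ∈ family N ↔
      ∃ (M : Fin k → Neg S) (hM : ∀ l, (Design.neg (M l)).Closed),
        (∀ l, M l ∈ N l) ∧ G = ofFin M hM := by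
  constructor
  · rintro ⟨hbase, hGN⟩
    refine ⟨_, fun l => G.atomic _, hGN, ?_⟩
    obtain ⟨base, design, atomic⟩ := G
    obtain rfl : base = Finset.range k := hbase
    rfl
  · rintro ⟨M, hM, hMN, rfl⟩
    exact ⟨rfl, hMN⟩

theorem orth_ofFin_iff {k : ℕ} {P : Pos S} (hP : (Design.pos P).fv ⊆ Set.Iio k)
    {M : Fin k → Neg S} (hM : ∀ l, (Design.neg (M l)).Closed) :
    Orth P (ofFin M hM) ↔ Converges (P.subst (instantiate M)) := by
  have htoSubst {x : ℕ} (hx : x < k) : (ofFin M hM).toSubst x = M ⟨x, hx⟩ :=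
    dif_pos (Finset.mem_range.2 hx)
  have hsubst : P.subst (ofFin M hM).toSubst = P.subst (instantiate M) :=
    Pos.subst_congr fun x hx => by
      rw [htoSubst (hP hx), instantiate, dif_pos (show x < k from hP hx)]
  rw [Orth, ← hsubst]
  refine and_iff_right (Design.closed_subst fun x hx => ?_)
  rw [htoSubst (hP hx)]
  exact hM _

theorem mem_orthSet_family_iff {k : ℕ} {P : Pos S} (hloc : (Design.pos P).LocallyStandard)
    (hP : (Design.pos P).fv ⊆ Set.Iio k) {N : Fin k → Set (Neg S)}
    (hN : ∀ l, ∀ M ∈ N l, (Design.neg M).Closed) (hne : ∀ l, (N l).Nonempty) :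
    P ∈ orthSet (family N) ↔
      ∀ M : Fin k → Neg S, (∀ l, M l ∈ N l) → Converges (P.subst (instantiate M)) := by
  refine ⟨fun h M hM => ?_, fun h => ⟨?_, fun G hG => ?_⟩⟩
  · have hMc (l) : (Design.neg (M l)).Closed := hN l _ (hM l)
    exact (orth_ofFin_iff hP hMc).1 (h.2 _ (mem_family_iff.2 ⟨M, hMc, hM, rfl⟩))
  · choose M hM using hne
    refine Design.standard_iff.2 ⟨hloc, by simp, ?_, (Set.finite_Iio k).subset hP⟩
    rintro ⟨⟩
    exact not_converges_omega (Pos.subst_omega (S := S) _ ▸ h M hM)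
  · obtain ⟨M, hMc, hM, rfl⟩ := mem_family_iff.1 hG
    exact (orth_ofFin_iff hP hMc).2 (h M hM)

end AntiDesign

/-! ### Internal completeness -/

open scoped Classical in
/-- The sum whose branch at `a` is `P` and whose other branches are `✠`.  An action `x₀ | b̄⟨M⃗⟩` is
cut against it to probe its name and its arguments. -/
noncomputable def NegF.probe (a : S.Name) (P : Pos S) : Neg S :=
  sum (Function.update (fun _ => Pos.daimon) a P)

section Probe

variable {a : S.Name} {P : Pos S}

theorem closed_probe (hP : (Design.pos P).fv ⊆ Set.Iio (S.ar a)) :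
    (Design.neg (NegF.probe a P)).Closed := by
  classical
  refine Design.closed_sum_iff.2 fun b => ?_
  obtain rfl | hb := eq_or_ne b a
  · rwa [Function.update_self]
  · simp [Function.update_of_ne hb]

theorem standard_probe (hloc : (Design.pos P).LocallyStandard)
    (hP : (Design.pos P).fv ⊆ Set.Iio (S.ar a)) : (Design.neg (NegF.probe a P)).Standard := by
  classical
  refine Design.standard_sum (fun b => ?_) (closed_probe hP)
  obtain rfl | hb := eq_or_ne b a
  · rwa [Function.update_self]
  · rw [Function.update_of_ne hb]
    exact Design.locallyStandard_daimon

theorem orth_act_probe_iff (hP : (Design.pos P).fv ⊆ Set.Iio (S.ar a))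
    {M : Fin (S.ar a) → Neg S} (hM : ∀ l, (Design.neg (M l)).Closed) :
    Orth (Pos.act a (NegF.var 0) M) (NegF.probe a P) ↔ Converges (P.subst (instantiate M)) := by
  classical
  rw [NegF.probe, orth_act_sum_iff hM (closed_probe hP), Function.update_self]

end Probe

theorem subst_rename_add_instantiate {k : ℕ} {P : Pos S} (hP : (Design.pos P).Atomic)
    (M : Fin k → Neg S) (l : Fin k) :
    (P.rename (· + l)).subst (instantiate M) = P.subst (single (M l)) := by
  rw [Pos.subst_rename]
  refine Pos.subst_congr fun x hx => ?_
  obtain rfl : x = 0 := hP hx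
  simp [instantiate, single]

theorem fv_rename_add_subset {k : ℕ} {P : Pos S} (hP : (Design.pos P).Atomic) (l : Fin k) :
    (Design.pos (P.rename (· + l))).fv ⊆ Set.Iio k := by
  intro x hx
  obtain ⟨y, hy, rfl⟩ := Design.fv_rename_subset (· + (l : ℕ)) (.pos P) hx
  obtain rfl : y = 0 := hP hy
  simp

section InternalCompleteness

variable {ι : Type*} {s : Set ι} {name : ι → S.Name} {N : ∀ i, Fin (S.ar (name i)) → Set (Neg S)}

theorem probe_mem_orthPos_biUnion_actSet (hN : ∀ i ∈ s, ∀ l, ∀ M ∈ N i l, (Design.neg M).Closed)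
    {a : S.Name} {P : Pos S} (hloc : (Design.pos P).LocallyStandard)
    (hP : (Design.pos P).fv ⊆ Set.Iio (S.ar a))
    (h : ∀ i ∈ s, name i = a → ∀ M : Fin (S.ar (name i)) → Neg S, (∀ l, M l ∈ N i l) →
      Converges (P.subst (instantiate M))) :
    NegF.probe a P ∈ orthPos (⋃ i ∈ s, actSet (name i) (N i)) := by
  classical
  have hstd := standard_probe hloc hP
  have hc := closed_probe hP
  refine (mem_orthPos_biUnion_iff hstd hc).2 fun i hi =>
    (sum_mem_orthPos_actSet_iff (hN i hi) hstd hc).2 fun M hM => ?_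
  by_cases hia : name i = a
  · subst hia
    rw [Function.update_self]
    exact h i hi rfl M hM
  · rw [Function.update_of_ne hia, Pos.subst_daimon]
    exact converges_daimon

theorem exists_name_eq_of_act_mem_biorthogonal
    (hN : ∀ i ∈ s, ∀ l, ∀ M ∈ N i l, (Design.neg M).Closed) {a : S.Name}
    {M : Fin (S.ar a) → Neg S} (hM : ∀ l, (Design.neg (M l)).Closed)
    (h : Pos.act a (NegF.var 0) M ∈ orthNeg (orthPos (⋃ i ∈ s, actSet (name i) (N i)))) :
    ∃ i ∈ s, name i = a := by
  by_contra! ha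
  have hfv : (Design.pos (Pos.omega : Pos S)).fv ⊆ Set.Iio (S.ar a) := by simp
  have hprobe : NegF.probe a Pos.omega ∈ orthPos (⋃ i ∈ s, actSet (name i) (N i)) :=
    probe_mem_orthPos_biUnion_actSet hN Design.locallyStandard_omega hfv
      fun i hi hia => absurd hia (ha i hi)
  have hconv := (orth_act_probe_iff hfv hM).1 (h.2.2 _ hprobe)
  rw [Pos.subst_omega] at hconv
  exact not_converges_omega hconv

theorem arg_mem_biorthogonal_of_act_mem_biorthogonal (hs : s.InjOn name)
    (hN : ∀ i ∈ s, ∀ l, ∀ M ∈ N i l, (Design.neg M).Closed) {i : ι} (hi : i ∈ s)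
    {M : Fin (S.ar (name i)) → Neg S} (hM : ∀ l, (Design.neg (M l)).Standard)
    (hMc : ∀ l, (Design.neg (M l)).Closed)
    (h : Pos.act (name i) (NegF.var 0) M ∈ orthNeg (orthPos (⋃ i ∈ s, actSet (name i) (N i))))
    (l : Fin (S.ar (name i))) : M l ∈ orthPos (orthNeg (N i l)) := by
  refine ⟨hM l, hMc l, fun R ⟨hR, hRat, hRorth⟩ => ?_⟩
  have hfv : (Design.pos (R.rename (· + l))).fv ⊆ Set.Iio (S.ar (name i)) :=
    fv_rename_add_subset hRat l
  have hprobe : NegF.probe (name i) (R.rename (· + l)) ∈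
      orthPos (⋃ i ∈ s, actSet (name i) (N i)) := by
    refine probe_mem_orthPos_biUnion_actSet hN
      (hR.locallyStandard.rename (add_left_injective (l : ℕ))) hfv fun j hj hji M' hM' => ?_
    obtain rfl := hs hj hi hji
    rw [subst_rename_add_instantiate hRat]
    exact (hRorth _ (hM' l)).2
  have hconv := (orth_act_probe_iff hfv hMc).1 (h.2.2 _ hprobe)
  rw [subst_rename_add_instantiate hRat] at hconv
  exact (orth_iff_converges hRat (hMc l)).2 hconv

theorem orthNeg_orthPos_biUnion_actSet (hs : s.InjOn name)
    (hN : ∀ i ∈ s, ∀ l, IsNegABehaviour (N i l)) :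
    orthNeg (orthPos (⋃ i ∈ s, actSet (name i) (N i))) =
      (⋃ i ∈ s, actSet (name i) (N i)) ∪ {Pos.daimon} := by
  have hc : ∀ i ∈ s, ∀ l, ∀ M ∈ N i l, (Design.neg M).Closed :=
    fun i hi l M hM => ((hN i hi l).1 M hM).2
  refine Set.Subset.antisymm (fun P hP => ?_)
    (Set.union_subset (subset_orthNeg_orthPos fun P hP => ?_)
      (Set.singleton_subset_iff.2 (daimon_mem_orthNeg _)))
  · obtain rfl | ⟨a, M, rfl, hM, hMc⟩ := hP.1.eq_daimon_or_act hP.2.1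
    · exact .inr rfl
    · obtain ⟨i, hi, rfl⟩ := exists_name_eq_of_act_mem_biorthogonal hc hMc hP
      refine .inl (Set.mem_biUnion hi ⟨M, fun l => ?_, rfl⟩)
      rw [(hN i hi l).2]
      exact arg_mem_biorthogonal_of_act_mem_biorthogonal hs hc hi hM hMc hP l
  · obtain ⟨i, hi, M, hM, rfl⟩ := Set.mem_iUnion₂.1 hP
    have hMN (l) := (hN i hi l).1 _ (hM l)
    exact ⟨Design.standard_act (fun l => (hMN l).1) fun l => (hMN l).2,
      Design.atomic_act fun l => (hMN l).2⟩

end InternalCompleteness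

theorem sum_mem_orthPos_actSet_iff_mem_orthSet_family {a : S.Name}
    {N : Fin (S.ar a) → Set (Neg S)} (hN : ∀ l, ∀ M ∈ N l, (Design.neg M).Closed)
    (hne : ∀ l, (N l).Nonempty) {Q : S.Name → Pos S}
    (hQ : (Design.neg (NegF.sum Q)).Standard) (hQc : (Design.neg (NegF.sum Q)).Closed) :
    NegF.sum Q ∈ orthPos (actSet a N) ↔ Q a ∈ AntiDesign.orthSet (AntiDesign.family N) := by
  rw [sum_mem_orthPos_actSet_iff hN hQ hQc, AntiDesign.mem_orthSet_family_iff
    (hQ.locallyStandard.mono (.branch a .refl)) (Design.closed_sum_iff.1 hQc a) hN hne]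

end Ludics

open Ludics in
theorem mainTheorem4_general {S : Signature.{u}} {ι : Type*} (s : Set ι)
    (name : ι → S.Name) :
    (s.InjOn name → ∀ N : ∀ i, Fin (S.ar (name i)) → Set (Neg S),
      (∀ i ∈ s, ∀ l, IsNegABehaviour (N i l)) →
      orthNeg (orthPos (⋃ i ∈ s, actSet (name i) (N i))) =
        (⋃ i ∈ s, actSet (name i) fun l => orthPos (orthNeg (N i l))) ∪ {Pos.daimon}) ∧
    (∀ P : ∀ i, Fin (S.ar (name i)) → Set (Pos S),
      (∀ i ∈ s, ∀ l, ∀ R ∈ P i l, (Design.pos R).Standard ∧ (Design.pos R).Atomic) →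
      ∀ Q : S.Name → Pos S,
        (Design.neg (NegF.sum Q)).Standard → (Design.neg (NegF.sum Q)).Atomic →
        ((∀ i ∈ s, NegF.sum Q ∈ orthPos (actSet (name i) fun l => orthPos (P i l))) ↔
          ∀ i ∈ s, Q (name i) ∈
            AntiDesign.orthSet (AntiDesign.family fun l => orthPos (P i l)))) := by
  refine ⟨fun hs N hN => ?_, fun P hP Q hQ hQc => forall₂_congr fun i hi => ?_⟩
  · have hNN : ⋃ i ∈ s, actSet (name i) (fun l => orthPos (orthNeg (N i l))) =
        ⋃ i ∈ s, actSet (name i) (N i) :=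
      Set.iUnion₂_congr fun i hi => congrArg _ (funext fun l => (hN i hi l).2.symm)
    rw [hNN, orthNeg_orthPos_biUnion_actSet hs hN]
  · exact sum_mem_orthPos_actSet_iff_mem_orthSet_family (fun _ _ hM => hM.2.1)
      (fun l => orthPos_nonempty (hP i hi l)) hQ hQc

theorem mainTheorem4 {S : Ludics.Signature.{u}} {n : ℕ} (α : Ludics.Connective S n)
    (h : α.Harmony) : α.DuallyDecomposable := by
  obtain ⟨intro, elim, _, _, hname, _⟩ := α
  obtain rfl : elim = intro := h.1.antisymm h.2
  obtain ⟨hE, hI⟩ := mainTheorem4_general elim Ludics.NegAction.name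
  exact ⟨fun N hN => hE (hname.mono Set.subset_union_left) _ fun p _ l => hN (p.vars l),
    fun P hP Q hQ hQc => ((and_iff_right hQ).trans (and_iff_right hQc)).trans
      (hI (fun p l => P (p.vars l)) (fun p _ l => (hP (p.vars l)).1) Q hQ hQc)⟩
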